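/- For a lattice $L$ and $x,y,z\in L$ define $y_0=y$, $z_0=z$, $y_{k+1}=y\vee(x\wedge z_k)$, $z_{k+1}=z\vee(x\wedge y_k)$ for $k\ge 0$. Say that $L$ is \emph{meet semidistributive at $k$}, or satisfies $SD_k(\wedge)$, if $x\wedge y_k=x\wedge(y\vee z)$ for all $x,y,z\in L$. For $n\ge 0$ and $v=(v_1,\dots,v_n)\in\mathbb N^n$ (where $0 \in \mathbb N$), the multinomial lattice $\mathcal L(v)$ is the set of words over the alphabet $a_1<\dots<a_n$ in which each letter $a_i$ occurs exactly $v_i$ times, ordered by the reflexive transitive closure of the rewriting relation $w\,a_i a_j\,u\to w\,a_j a_i\,u$ for $i<j$; this poset is a lattice. \textbf{Statement.} Let $n\ge 0$ and $v\in\mathbb N^n$. Then $\mathcal L(v)$ satisfies $SD_k(\wedge)$ for every integer $k\ge 0$ with $k\ge n-1$. If moreover $v_i>0$ for all $i=1,\dots,n$, then this bound is optimal: $\max(n-1,0)$ is the least integer $k\ge 0$ such that $\mathcal L(v)$ satisfies $SD_k(\wedge)$ (in particular, $SD_{n-2}(\wedge)$ fails in $\mathcal L(v)$ when $n\ge 2$).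 -/

import Mathlib

/-!
Multinomial lattices (words with a prescribed number of occurrences of every letter, ordered by
the rewriting `a_i a_j → a_j a_i` for `i < j`), and meet semidistributivity at `k`.
-/

/-- One elementary rewriting step `s a_i a_j t → s a_j a_i t` with `i < j`. -/
inductive WordStep {n : ℕ} : List (Fin n) → List (Fin n) → Prop
  | swap (s t : List (Fin n)) (i j : Fin n) (hij : i < j) :
      WordStep (s ++ i :: j :: t) (s ++ j :: i :: t)

/-- The carrier of the multinomial lattice `L(v)`, `v ∈ ℕ^n`: the words over the alphabet
`a_0 < ⋯ < a_{n-1}` in which the letter `a_i` occurs exactly `v i` times. -/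
def MultinomialLattice {n : ℕ} (v : Fin n → ℕ) : Type :=
  {w : List (Fin n) // ∀ i, w.count i = v i}

namespace MultinomialLattice

/-! ### The order -/

theorem lex_lt_of_step {n : ℕ} {a b : List (Fin n)} (h : WordStep a b) : a < b := by
  obtain ⟨s, t, i, j, hij⟩ := h
  induction s with
  | nil => exact List.Lex.rel hij
  | cons c s ih => exact List.Lex.cons ih

theorem lex_le_of_reflTransGen {n : ℕ} {a b : List (Fin n)}
    (h : Relation.ReflTransGen WordStep a b) : a ≤ b := by
  induction h with
  | refl => exact le_rfl
  | tail _ h ih => exact ih.trans (lex_lt_of_step h).le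

variable {n : ℕ} {v : Fin n → ℕ}

/-- The order of `L(v)`: the reflexive transitive closure of the rewriting steps. -/
instance : PartialOrder (MultinomialLattice v) where
  le a b := Relation.ReflTransGen WordStep a.1 b.1
  le_refl _ := Relation.ReflTransGen.refl
  le_trans _ _ _ h h' := Relation.ReflTransGen.trans h h'
  le_antisymm _ _ h h' :=
    Subtype.ext (le_antisymm (lex_le_of_reflTransGen h) (lex_le_of_reflTransGen h'))

theorem le_def (a b : MultinomialLattice v) :
    a ≤ b ↔ Relation.ReflTransGen WordStep a.1 b.1 := Iff.rfl

/-! ### This order is a lattice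

`(i, p)` stands for the occurrence number `p` (counted from `0`) of the letter `a_i`. -/

/-- In the word `w` the occurrence `a` comes before the occurrence `b`. -/
def Before (w : List (Fin n)) (a b : Fin n × ℕ) : Prop :=
  ∃ s, s <+: w ∧ a.2 < s.count a.1 ∧ s.count b.1 ≤ b.2

/-- The inversions of the word `w`. -/
def Inv (v : Fin n → ℕ) (w : List (Fin n)) (a b : Fin n × ℕ) : Prop :=
  a.1 < b.1 ∧ a.2 < v a.1 ∧ b.2 < v b.1 ∧ Before w b a

/-- Strict lexicographic order on occurrences. -/
def LexLt (a b : Fin n × ℕ) : Prop := a.1 < b.1 ∨ a.1 = b.1 ∧ a.2 < b.2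

/-- Clopen sets of pairs of occurrences. -/
structure Clopen (v : Fin n → ℕ) (I : Fin n × ℕ → Fin n × ℕ → Prop) : Prop where
  sub : ∀ a b, I a b → a.1 < b.1 ∧ a.2 < v a.1 ∧ b.2 < v b.1
  trans : ∀ a b c, I a b → I b c → I a c
  cotrans : ∀ a b c, I a c → b.2 < v b.1 → LexLt a b → LexLt b c → I a b ∨ I b c

theorem Before.trans {w : List (Fin n)} {a b c : Fin n × ℕ}
    (h : Before w a b) (h' : Before w b c) : Before w a c := by
  obtain ⟨s, hs, h1, h2⟩ := h
  obtain ⟨s', hs', h3, h4⟩ := h'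
  refine ⟨s', hs', ?_, h4⟩
  rcases List.prefix_or_prefix_of_prefix hs hs' with h | h
  · exact h1.trans_le (h.sublist.count_le a.1)
  · have := h.sublist.count_le b.1
    omega

theorem Before.asymm {w : List (Fin n)} {a b : Fin n × ℕ}
    (h : Before w a b) (h' : Before w b a) : False := by
  obtain ⟨s, hs, h1, h2⟩ := h.trans h'
  omega

theorem clopen_inv (w : List (Fin n)) : Clopen v (Inv v w) where
  sub _ _ h := ⟨h.1, h.2.1, h.2.2.1⟩
  trans _ _ _ h h' := ⟨h.1.trans h'.1, h.2.1, h'.2.2.1, h'.2.2.2.trans h.2.2.2⟩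
  cotrans := by
    rintro ⟨i, p⟩ ⟨k, r⟩ ⟨j, q⟩ ⟨h1, h2, h3, s, hs, h4, h5⟩ hb hab hbc
    simp only [LexLt] at *
    rcases lt_or_ge r (s.count k) with h | h
    · left
      refine ⟨?_, h2, hb, s, hs, h, h5⟩
      rcases hab with hab | ⟨rfl, hab⟩
      · exact hab
      · omega
    · right
      refine ⟨?_, hb, h3, s, hs, h4, h⟩
      rcases hbc with hbc | ⟨rfl, hbc⟩
      · exact hbc
      · omega

theorem LexLt.trans {a b c : Fin n × ℕ} (h : LexLt a b) (h' : LexLt b c) : LexLt a c := by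
  obtain ⟨a1, a2⟩ := a
  obtain ⟨b1, b2⟩ := b
  obtain ⟨c1, c2⟩ := c
  simp only [LexLt] at *
  omega

theorem LexLt.trichotomy (a b : Fin n × ℕ) : LexLt a b ∨ a = b ∨ LexLt b a := by
  obtain ⟨a1, a2⟩ := a
  obtain ⟨b1, b2⟩ := b
  simp only [LexLt, Prod.mk.injEq]
  omega

/-- The linear order whose inversions form the clopen set `I`. -/
def LinOf (I : Fin n × ℕ → Fin n × ℕ → Prop) (a b : Fin n × ℕ) : Prop :=
  LexLt a b ∧ ¬ I a b ∨ I b a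

theorem Clopen.lexLt {I : Fin n × ℕ → Fin n × ℕ → Prop} (hI : Clopen v I) {a b : Fin n × ℕ}
    (h : I a b) : LexLt a b := Or.inl (hI.sub a b h).1

theorem Clopen.linOf_trans {I : Fin n × ℕ → Fin n × ℕ → Prop} (hI : Clopen v I)
    {a b c : Fin n × ℕ} (ha : a.2 < v a.1) (hb : b.2 < v b.1) (hc : c.2 < v c.1)
    (h : LinOf I a b) (h' : LinOf I b c) : LinOf I a c := by
  rcases h with ⟨h1, h2⟩ | h <;> rcases h' with ⟨h3, h4⟩ | h'
  · left
    exact ⟨h1.trans h3, fun h => (hI.cotrans a b c h hb h1 h3).elim h2 h4⟩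
  · rcases LexLt.trichotomy a c with h | rfl | h
    · exact Or.inl ⟨h, fun hh => h2 (hI.trans _ _ _ hh h')⟩
    · exact absurd h' h2
    · exact Or.inr ((hI.cotrans c a b h' ha h h1).resolve_right h2)
  · rcases LexLt.trichotomy a c with h' | rfl | h'
    · exact Or.inl ⟨h', fun hh => h4 (hI.trans _ _ _ h hh)⟩
    · exact absurd h h4
    · exact Or.inr ((hI.cotrans b c a h hc h3 h').resolve_left h4)
  · exact Or.inr (hI.trans _ _ _ h' h)

theorem exists_split (w : List (Fin n)) (j : Fin n) :
    ∀ q, q < w.count j → ∃ s t, w = s ++ j :: t ∧ s.count j = q := by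
  induction w with
  | nil => intro q h; simp at h
  | cons c w ih =>
    intro q h
    by_cases hc : c = j
    · subst hc
      cases q with
      | zero => exact ⟨[], w, rfl, rfl⟩
      | succ q =>
        obtain ⟨s, t, rfl, hs⟩ := ih q (by simpa using h)
        exact ⟨c :: s, t, rfl, by simp [hs]⟩
    · obtain ⟨s, t, rfl, hs⟩ := ih q (by simpa [List.count_cons, hc] using h)
      exact ⟨c :: s, t, rfl, by simp [List.count_cons, hc, hs]⟩

theorem count_lt {w s t : List (Fin n)} {i : Fin n} (hw : ∀ i, w.count i = v i)
    (h : w = s ++ i :: t) : s.count i < v i := by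
  rw [← hw, h]
  simp

/-- A word all of whose consecutive occurrences are in the order given by `I` has all its
occurrences in that order. -/
theorem linOf_of_adjacent {I : Fin n × ℕ → Fin n × ℕ → Prop} (hI : Clopen v I)
    {w : List (Fin n)} (hw : ∀ i, w.count i = v i)
    (hadj : ∀ s t i j, w = s ++ i :: j :: t →
      LinOf I (i, s.count i) (j, (s ++ [i]).count j)) (s : List (Fin n)) :
    ∀ j t, w = s ++ j :: t → ∀ k r, r < s.count k → LinOf I (k, r) (j, s.count j) := by
  induction s using List.reverseRecOn with
  | nil => intro j t _ k r h; simp at h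
  | append_singleton s i ih =>
    intro j t h k r hr
    have hw' : w = s ++ i :: j :: t := by simpa using h
    have h1 := hadj s t i j hw'
    by_cases hk : r < s.count k
    · have hk' : r < v k := by
        have := count_lt (i := j) hw h
        rw [← hw, hw']
        simp only [List.count_append]
        omega
      exact hI.linOf_trans hk' (count_lt hw hw') (count_lt hw h) (ih i _ hw' k r hk) h1
    · have : k = i ∧ r = s.count i := by
        rw [List.count_append, List.count_singleton] at hr
        by_cases hki : i = k
        · subst hki
          simp at hr
          exact ⟨rfl, by omega⟩
        · simp [hki] at hr
          omega
      obtain ⟨rfl, rfl⟩ := this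
      exact h1

theorem prefix_append_cases {u s t : List (Fin n)} (h : u <+: s ++ t) :
    u <+: s ∨ ∃ u', u = s ++ u' ∧ u' <+: t := by
  rcases List.prefix_or_prefix_of_prefix h (List.prefix_append s t) with h' | ⟨u', rfl⟩
  · exact Or.inl h'
  · exact Or.inr ⟨u', rfl, (List.prefix_append_right_inj _).1 h⟩

/-- Swapping two consecutive letters adds a single inversion. -/
theorem inv_swap {I : Fin n × ℕ → Fin n × ℕ → Prop} {s t : List (Fin n)} {i j : Fin n}
    (hij : i < j) (hI : ∀ a b, Inv v (s ++ i :: j :: t) a b → I a b)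
    (h : I (i, s.count i) (j, s.count j)) :
    ∀ a b, Inv v (s ++ j :: i :: t) a b → I a b := by
  rintro ⟨l, p⟩ ⟨k, q⟩ ⟨h1, h2, h3, u, hu, h4, h5⟩
  simp only at h1 h2 h3 h4 h5
  have key : ∀ u', u' <+: s ++ i :: j :: t → q < u'.count k → u'.count l ≤ p → I (l, p) (k, q) :=
    fun u' a b c => hI _ _ ⟨h1, h2, h3, u', a, b, c⟩
  rcases prefix_append_cases hu with hu | ⟨u1, rfl, hu1⟩
  · exact key u (hu.trans (List.prefix_append _ _)) h4 h5
  rcases List.prefix_cons_iff.1 hu1 with rfl | ⟨u2, rfl, hu2⟩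
  · exact key s (List.prefix_append _ _) (by simpa using h4) (by simpa using h5)
  rcases List.prefix_cons_iff.1 hu2 with rfl | ⟨u3, rfl, hu3⟩
  · by_cases hq : q < s.count k
    · refine key s (List.prefix_append _ _) hq ?_
      rw [List.count_append] at h5
      omega
    · rw [List.count_append, List.count_singleton] at h4 h5
      have hk : j = k := by
        by_contra hk
        simp [hk] at h4
        omega
      subst hk
      have hlj : ¬ j = l := h1.ne'
      simp [hlj] at h4 h5
      have hq' : q = s.count j := by omega
      by_cases hl : l = i ∧ p = s.count i
      · obtain ⟨rfl, rfl⟩ := hl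
        rw [hq']
        exact h
      · refine key (s ++ [i, j]) ⟨t, by simp⟩ ?_ ?_
        · simp [List.count_append, List.count_cons]
          omega
        · simp [List.count_append, List.count_cons, hlj]
          by_cases hil : i = l
          · subst hil
            simp at hl ⊢
            omega
          · simp [hil, h5]
  · refine key (s ++ i :: j :: u3) ?_ ?_ ?_
    · rw [List.prefix_append_right_inj]
      simpa [List.cons_prefix_cons] using hu3
    · simp only [List.count_append, List.count_cons] at h4 ⊢
      omega
    · simp only [List.count_append, List.count_cons] at h5 ⊢
      omega

instance : Finite (MultinomialLattice v) := by
  have : Set.Finite {w : List (Fin n) | ∀ i, w.count i = v i} := by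
    refine (List.finite_length_eq (Fin n) (∑ i, v i)).subset fun w hw => ?_
    have := Multiset.sum_count_eq_card (s := Finset.univ) (m := (w : Multiset (Fin n))) (by simp)
    simp only [Multiset.coe_count, Multiset.coe_card] at this
    rw [Set.mem_ofPred_eq, ← this]
    exact Finset.sum_congr rfl fun i _ => hw i
  exact this.to_subtype

/-- Every word whose inversions lie in a clopen set `I` can be rewritten to a word whose set of
inversions is `I`. -/
theorem exists_ge_inv_eq {I : Fin n × ℕ → Fin n × ℕ → Prop} (hI : Clopen v I)
    (w : MultinomialLattice v) (hw : ∀ a b, Inv v w.1 a b → I a b) :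
    ∃ u : MultinomialLattice v, w ≤ u ∧ ∀ a b, Inv v u.1 a b ↔ I a b := by
  induction w using (wellFounded_gt (α := MultinomialLattice v)).induction with
  | _ w ih =>
  by_cases hadj : ∀ s t i j, w.1 = s ++ i :: j :: t →
      LinOf I (i, s.count i) (j, (s ++ [i]).count j)
  · refine ⟨w, le_rfl, fun a b => ⟨hw a b, fun h => ?_⟩⟩
    obtain ⟨i, p⟩ := a
    obtain ⟨j, q⟩ := b
    obtain ⟨h1, h2, h3⟩ := hI.sub _ _ h
    simp only at h1 h2 h3
    obtain ⟨s, t, hs, rfl⟩ := exists_split w.1 j q (by rw [w.2]; exact h3)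
    refine ⟨h1, h2, h3, ?_⟩
    by_cases hp : p < s.count i
    · rcases linOf_of_adjacent hI w.2 hadj s j t hs i p hp with h' | h'
      · exact absurd h h'.2
      · exact absurd (hI.sub _ _ h').1 h1.asymm
    · refine ⟨s ++ [j], ⟨t, by simp [hs]⟩, by simp, ?_⟩
      have : ¬ j = i := h1.ne'
      simp [List.count_append, List.count_cons, this]
      omega
  · push Not at hadj
    obtain ⟨s, t, i, j, hs, hT⟩ := hadj
    have hb1 : s.count i < v i := count_lt w.2 hs
    have hb2 : (s ++ [i]).count j < v j := count_lt (t := t) w.2 (by simpa using hs)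
    rcases lt_trichotomy i j with hij | rfl | hij
    · have hc : (s ++ [i]).count j = s.count j := by
        simp [List.count_append, List.count_cons, hij.ne]
      rw [hc] at hT
      have h : I (i, s.count i) (j, s.count j) := by
        by_contra h
        exact hT (Or.inl ⟨Or.inl hij, h⟩)
      let w' : MultinomialLattice v := ⟨s ++ j :: i :: t, fun k => by
        rw [← w.2 k, hs]
        simp only [List.count_append, List.count_cons]
        omega⟩
      have hst : WordStep w.1 w'.1 := by rw [hs]; exact WordStep.swap s t i j hij
      have hle : w ≤ w' := Relation.ReflTransGen.single hst
      have hlt : w < w' := lt_of_le_of_ne hle fun e =>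
        (lex_lt_of_step hst).ne (congrArg Subtype.val e)
      obtain ⟨u, hu, hu'⟩ := ih w' hlt (inv_swap hij (by rw [← hs]; exact hw) h)
      exact ⟨u, hle.trans hu, hu'⟩
    · exact absurd (Or.inl ⟨Or.inr ⟨rfl, by simp⟩, fun h => (hI.sub _ _ h).1.ne rfl⟩) hT
    · have hc : (s ++ [i]).count j = s.count j := by
        simp [List.count_append, List.count_cons, hij.ne']
      rw [hc] at hT hb2
      refine absurd (Or.inr (hw _ _ ⟨hij, hb2, hb1, s ++ [i], ⟨j :: t, by simp [hs]⟩, ?_, ?_⟩)) hT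
      · simp
      · exact hc.le

theorem eq_of_inv_aux (w u : List (Fin n)) (hw : ∀ i, w.count i = v i)
    (hu : ∀ i, u.count i = v i) (h : ∀ a b, Inv v w a b ↔ Inv v u a b) :
    ∀ t t' s, w = s ++ t → u = s ++ t' → t = t' := by
  have key : ∀ (w u : List (Fin n)), (∀ i, w.count i = v i) → (∀ i, u.count i = v i) →
      (∀ a b, Inv v w a b ↔ Inv v u a b) → ∀ s t t' i j, w = s ++ i :: t → u = s ++ j :: t' →
      ¬ i < j := by
    intro w u hw hu h s t t' i j h1 h2 hij
    have hB : ∀ x, Before (s ++ j :: x) (j, s.count j) (i, s.count i) := fun x =>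
      ⟨s ++ [j], ⟨x, by simp⟩, by simp, by simp [List.count_append, List.count_cons, hij.ne']⟩
    have hB' : ∀ x, Before (s ++ i :: x) (i, s.count i) (j, s.count j) := fun x =>
      ⟨s ++ [i], ⟨x, by simp⟩, by simp, by simp [List.count_append, List.count_cons, hij.ne]⟩
    have := (h (i, s.count i) (j, s.count j)).2
      ⟨hij, count_lt hw h1, count_lt hu h2, by rw [h2]; exact hB _⟩
    exact this.2.2.2.asymm (by rw [h1]; exact hB' _)
  intro t
  induction t with
  | nil =>
    intro t' s h1 h2
    cases t' with
    | nil => rfl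
    | cons j t' =>
      have h3 := count_lt hu h2
      rw [← hw j, h1] at h3
      simp at h3
  | cons i t ih =>
    intro t' s h1 h2
    cases t' with
    | nil =>
      have h3 := count_lt hw h1
      rw [← hu i, h2] at h3
      simp at h3
    | cons j t' =>
      have hij : i = j := le_antisymm
        (not_lt.1 (key u w hu hw (fun a b => (h a b).symm) s t' t j i h2 h1))
        (not_lt.1 (key w u hw hu h s t t' i j h1 h2))
      subst hij
      rw [ih t' (s ++ [i]) (by simpa using h1) (by simpa using h2)]

theorem eq_of_inv {w u : MultinomialLattice v} (h : ∀ a b, Inv v w.1 a b ↔ Inv v u.1 a b) :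
    w = u :=
  Subtype.ext (eq_of_inv_aux w.1 u.1 w.2 u.2 h w.1 u.1 [] rfl rfl)

theorem inv_mono_of_step {w u : List (Fin n)} (h : WordStep w u) (a b : Fin n × ℕ)
    (hab : Inv v w a b) : Inv v u a b := by
  obtain ⟨s, t, i, j, hij⟩ := h
  obtain ⟨l, p⟩ := a
  obtain ⟨k, q⟩ := b
  obtain ⟨h1, h2, h3, x, hx, h4, h5⟩ := hab
  simp only at h1 h2 h3 h4 h5
  have key : ∀ u', u' <+: s ++ j :: i :: t → q < u'.count k → u'.count l ≤ p →
      Inv v (s ++ j :: i :: t) (l, p) (k, q) :=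
    fun u' a b c => ⟨h1, h2, h3, u', a, b, c⟩
  rcases prefix_append_cases hx with hx | ⟨u1, rfl, hx1⟩
  · exact key x (hx.trans (List.prefix_append _ _)) h4 h5
  rcases List.prefix_cons_iff.1 hx1 with rfl | ⟨u2, rfl, hx2⟩
  · exact key s (List.prefix_append _ _) (by simpa using h4) (by simpa using h5)
  rcases List.prefix_cons_iff.1 hx2 with rfl | ⟨u3, rfl, hx3⟩
  · rw [List.count_append, List.count_singleton] at h4 h5
    by_cases hk : i = k
    · subst hk
      have hjl : ¬ j = l := (h1.trans hij).ne'
      refine key (s ++ [j, i]) ⟨t, by simp⟩ ?_ ?_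
      · simp [List.count_append, List.count_cons] at h4 ⊢
        omega
      · simp [List.count_append, List.count_cons, hjl, h1.ne']
        omega
    · refine key s (List.prefix_append _ _) ?_ (by omega)
      simpa [hk] using h4
  · refine key (s ++ j :: i :: u3) ?_ ?_ ?_
    · rw [List.prefix_append_right_inj]
      simpa [List.cons_prefix_cons] using hx3
    · simp only [List.count_append, List.count_cons] at h4 ⊢
      omega
    · simp only [List.count_append, List.count_cons] at h5 ⊢
      omega

/-- The order of `L(v)` is the inclusion of sets of inversions. -/
theorem le_iff_inv (w u : MultinomialLattice v) :
    w ≤ u ↔ ∀ a b, Inv v w.1 a b → Inv v u.1 a b := by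
  constructor
  · intro h
    have h' : Relation.ReflTransGen WordStep w.1 u.1 := h
    clear h
    generalize u.1 = u' at h'
    induction h' with
    | refl => exact fun _ _ => id
    | tail _ h ih => exact fun a b hab => inv_mono_of_step h a b (ih a b hab)
  · intro h
    obtain ⟨x, hx, hx'⟩ := exists_ge_inv_eq (clopen_inv u.1) w h
    rwa [eq_of_inv hx'] at hx

theorem clopen_transGen {I J : Fin n × ℕ → Fin n × ℕ → Prop} (hI : Clopen v I)
    (hJ : Clopen v J) : Clopen v (Relation.TransGen fun a b => I a b ∨ J a b) where
  sub a b h := by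
    have hs : ∀ a b, I a b ∨ J a b → a.1 < b.1 ∧ a.2 < v a.1 ∧ b.2 < v b.1 :=
      fun a b h => h.elim (hI.sub a b) (hJ.sub a b)
    induction h with
    | single h => exact hs _ _ h
    | tail _ h ih => exact ⟨ih.1.trans (hs _ _ h).1, ih.2.1, (hs _ _ h).2.2⟩
  trans _ _ _ h h' := h.trans h'
  cotrans a b c h hb hab hbc := by
    have hco : ∀ a c, I a c ∨ J a c → LexLt a b → LexLt b c →
        (I a b ∨ J a b) ∨ (I b c ∨ J b c) := by
      rintro a c (h | h) h1 h2
      · exact (hI.cotrans a b c h hb h1 h2).imp Or.inl Or.inl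
      · exact (hJ.cotrans a b c h hb h1 h2).imp Or.inr Or.inr
    induction h with
    | single h => exact (hco _ _ h hab hbc).imp Relation.TransGen.single Relation.TransGen.single
    | @tail d e h hde ih =>
      rcases LexLt.trichotomy b d with h' | rfl | h'
      · exact (ih h').imp id fun x => x.tail hde
      · exact Or.inl h
      · exact (hco _ _ hde h' hbc).imp (fun x => h.tail x) Relation.TransGen.single

theorem exists_isLUB (x y : MultinomialLattice v) : ∃ z, IsLUB {x, y} z := by
  have hc := clopen_transGen (clopen_inv (v := v) x.1) (clopen_inv (v := v) y.1)
  obtain ⟨z, hxz, hz⟩ := exists_ge_inv_eq hc x fun a b h => .single (Or.inl h)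
  refine ⟨z, ?_, ?_⟩
  · rintro _ (rfl | rfl)
    · exact hxz
    · exact (le_iff_inv _ _).2 fun a b h => (hz a b).2 (.single (Or.inr h))
  · intro u hu
    have hx := (le_iff_inv x u).1 (hu (Set.mem_insert _ _))
    have hy := (le_iff_inv y u).1 (hu (Set.mem_insert_of_mem _ rfl))
    refine (le_iff_inv z u).2 fun a b h => ?_
    have h' := (hz a b).1 h
    clear h
    induction h' with
    | single h => exact h.elim (hx _ _) (hy _ _)
    | tail h' h ih =>
      exact (clopen_inv u.1).trans _ _ _ ih (h.elim (hx _ _) (hy _ _))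

/-- Reading a word from right to left. -/
def rev (x : MultinomialLattice v) : MultinomialLattice v :=
  ⟨x.1.reverse, fun i => by rw [List.count_reverse]; exact x.2 i⟩

theorem rev_rev (x : MultinomialLattice v) : x.rev.rev = x :=
  Subtype.ext (List.reverse_reverse _)

theorem rev_le_rev {x y : MultinomialLattice v} (h : x ≤ y) : y.rev ≤ x.rev := by
  have hstep : ∀ a b : List (Fin n), WordStep a b → WordStep b.reverse a.reverse := by
    rintro _ _ ⟨s, t, i, j, hij⟩
    simpa using WordStep.swap t.reverse s.reverse i j hij
  have h' : Relation.ReflTransGen WordStep x.1 y.1 := h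
  change Relation.ReflTransGen WordStep y.1.reverse x.1.reverse
  clear h
  generalize y.1 = y' at h' ⊢
  induction h' with
  | refl => exact .refl
  | tail _ h ih => exact ih.head (hstep _ _ h)

theorem exists_isGLB (x y : MultinomialLattice v) : ∃ z, IsGLB {x, y} z := by
  obtain ⟨z, hz, hz'⟩ := exists_isLUB x.rev y.rev
  refine ⟨z.rev, ?_, fun u hu => ?_⟩
  · rintro _ (rfl | rfl)
    · simpa [rev_rev] using rev_le_rev (hz (Set.mem_insert _ _))
    · simpa [rev_rev] using rev_le_rev (hz (Set.mem_insert_of_mem _ rfl))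
  · have : z ≤ u.rev := hz' (by
      rintro _ (rfl | rfl)
      · exact rev_le_rev (hu (Set.mem_insert _ _))
      · exact rev_le_rev (hu (Set.mem_insert_of_mem _ rfl)))
    simpa [rev_rev] using rev_le_rev this

/-- The lattice `L(v)`: joins and meets are the least upper bounds and the greatest lower bounds
for the rewriting order. -/
noncomputable instance : Lattice (MultinomialLattice v) where
  sup x y := (exists_isLUB x y).choose
  inf x y := (exists_isGLB x y).choose
  le_sup_left x y := (exists_isLUB x y).choose_spec.1 (Set.mem_insert _ _)
  le_sup_right x y := (exists_isLUB x y).choose_spec.1 (Set.mem_insert_of_mem _ rfl)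
  sup_le x y z h h' := (exists_isLUB x y).choose_spec.2 (by
    rintro _ (rfl | rfl)
    · exact h
    · exact h')
  inf_le_left x y := (exists_isGLB x y).choose_spec.1 (Set.mem_insert _ _)
  inf_le_right x y := (exists_isGLB x y).choose_spec.1 (Set.mem_insert_of_mem _ rfl)
  le_inf x y z h h' := (exists_isGLB y z).choose_spec.2 (by
    rintro _ (rfl | rfl)
    · exact h
    · exact h')

end MultinomialLattice

/-! ### Meet semidistributivity at `k` -/

/-- The pair `(y_k, z_k)`: `y_0 = y`, `z_0 = z`, `y_{k+1} = y ⊔ (x ⊓ z_k)`,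
`z_{k+1} = z ⊔ (x ⊓ y_k)`. -/
def sdSeq {L : Type*} [Lattice L] (x y z : L) : ℕ → L × L
  | 0 => (y, z)
  | k + 1 => (y ⊔ (x ⊓ (sdSeq x y z k).2), z ⊔ (x ⊓ (sdSeq x y z k).1))

/-- `L` satisfies the equation `SD_k(∧)`, i.e. `x ⊓ y_k = x ⊓ (y ⊔ z)`. -/
def MeetSemidistributiveAt (L : Type*) [Lattice L] (k : ℕ) : Prop :=
  ∀ x y z : L, x ⊓ (sdSeq x y z k).1 = x ⊓ (y ⊔ z)

/-!
An element of `L(v)` is determined by its clopen set of inversions, the order is inclusion, and the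
join is the transitive closure of the union.

*The bound `n - 1`.* Let `t = x ⊓ (y ⊔ z)`. By induction on `k`, every inversion `(a, b)` of `t`
whose letters are at distance at most `k` is an inversion of `y_k` and of `z_k`
(`inv_sdSeq_of_inv`). Indeed, `(a, b)` is joined by a path of inversions of `y` and of `z`. Every
intermediate point `c` of the path satisfies `(a, c) ∈ t` or `(c, b) ∈ t`, so somewhere the path has
a step `(c, d)` with `c = a` or `(a, c) ∈ t`, and `d = b` or `(d, b) ∈ t`
(`Clopen.exists_crossing_step`). The outer two pairs have smaller distance, hence lie in `y_{k-1}`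
and in `z_{k-1}`, and `(a, b)` is in `y_{k-1}` or in `z_{k-1}`, according to whether `(c, d)` is in
`y` or in `z`. In the second case `(a, b)` has to be in `x ⊓ z_{k-1}` in order to be in `y_k`, and
the inversions of a meet are in general fewer than the common ones: a clopen set of common inversions
that contains `(a, b)` is needed. The set `Below` of the pairs `(c, d)` in `[a, b]` with `(c, b) ∈ t`
and `(d, b) ∉ t` is one: it is contained in `t`, hence in `x`, and also in `z_{k-1}`, since its pairs
have smaller distance or have the same two letters as `(a, b)`.

*Optimality.* The clopen sets used for it depend on the letters only. Let `x` consist of the pairs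
`(0, j)`; the pairs `(i, i + 1)` are put alternately into `y` and `z`, with `(k, k + 1)` in `z`. Then
`(0, k + 1)` is in `x ⊓ (y ⊔ z)`, but each round of the iteration lets `(0, j)` advance by one letter
only, and `(0, k + 1)` is not in `y_k`. The sets `Ladder s m` bound the iterates from above.
-/

namespace MultinomialLattice

variable {n : ℕ} {v : Fin n → ℕ}

/-! ### Words with a given set of inversions -/

theorem exists_inv_empty (v : Fin n → ℕ) :
    ∃ w : MultinomialLattice v, ∀ a b, ¬ Inv v w.1 a b := by
  have hm : ∀ i, (∑ j, v j • ({j} : Multiset (Fin n))).sort.count i = v i := by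
    intro i
    rw [← Multiset.coe_count, Multiset.sort_eq, Multiset.count_sum']
    simp [Multiset.count_nsmul, Multiset.count_singleton]
  refine ⟨⟨_, hm⟩, ?_⟩
  rintro ⟨i, p⟩ ⟨j, q⟩ ⟨hij, hp, -, s, ⟨t, hst⟩, hj, hi⟩
  simp only at hij hp hj hi hst
  have hsort : (s ++ t).Pairwise (· ≤ ·) := by
    rw [hst]
    exact Multiset.pairwise_sort _ _
  have hcount : (s ++ t).count i = v i := by rw [hst, hm]
  rw [List.count_append] at hcount
  have hjs : j ∈ s := List.count_pos_iff.1 (by omega)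
  have hit : i ∈ t := List.count_pos_iff.1 (by omega)
  exact absurd ((List.pairwise_append.1 hsort).2.2 j hjs i hit) (not_le.2 hij)

theorem Clopen.exists_inv_iff {I : Fin n × ℕ → Fin n × ℕ → Prop} (hI : Clopen v I) :
    ∃ w : MultinomialLattice v, ∀ a b, Inv v w.1 a b ↔ I a b := by
  obtain ⟨w, hw⟩ := exists_inv_empty v
  obtain ⟨u, -, hu⟩ := exists_ge_inv_eq hI w fun a b h => absurd h (hw a b)
  exact ⟨u, hu⟩

theorem inv_mono {x y : MultinomialLattice v} (h : x ≤ y) {a b : Fin n × ℕ}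
    (hab : Inv v x.1 a b) : Inv v y.1 a b :=
  (le_iff_inv x y).1 h a b hab

theorem transGen_of_inv_sup {x y : MultinomialLattice v} {a b : Fin n × ℕ}
    (h : Inv v (x ⊔ y).1 a b) :
    Relation.TransGen (fun a b => Inv v x.1 a b ∨ Inv v y.1 a b) a b := by
  obtain ⟨w, hw⟩ := (clopen_transGen (clopen_inv (v := v) x.1)
    (clopen_inv (v := v) y.1)).exists_inv_iff
  refine (hw a b).1 (inv_mono (sup_le ?_ ?_) h)
  · exact (le_iff_inv _ _).2 fun a b h => (hw a b).2 (.single (Or.inl h))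
  · exact (le_iff_inv _ _).2 fun a b h => (hw a b).2 (.single (Or.inr h))

theorem Clopen.inv_inf {I : Fin n × ℕ → Fin n × ℕ → Prop} (hI : Clopen v I)
    {x y : MultinomialLattice v} (hx : ∀ a b, I a b → Inv v x.1 a b)
    (hy : ∀ a b, I a b → Inv v y.1 a b) {a b : Fin n × ℕ} (h : I a b) :
    Inv v (x ⊓ y).1 a b := by
  obtain ⟨w, hw⟩ := hI.exists_inv_iff
  refine inv_mono (le_inf ?_ ?_) ((hw a b).2 h)
  · exact (le_iff_inv _ _).2 fun a b h => hx a b ((hw a b).1 h)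
  · exact (le_iff_inv _ _).2 fun a b h => hy a b ((hw a b).1 h)

/-! ### The join irreducible clopen subset below an inversion -/

/-- The part of the clopen set `I` below its element `(a, b)`: the pairs `(c, d)` in `[a, b]` with
`(c, b) ∈ I` and `(d, b) ∉ I`. It contains `(a, b)`, as `(b, b) ∉ I`. -/
def Below (v : Fin n → ℕ) (I : Fin n × ℕ → Fin n × ℕ → Prop) (a b c d : Fin n × ℕ) : Prop :=
  (a = c ∨ LexLt a c) ∧ I c b ∧ (d = b ∨ LexLt d b) ∧ ¬ I d b ∧ LexLt c d ∧ d.2 < v d.1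

theorem Clopen.below_le {I : Fin n × ℕ → Fin n × ℕ → Prop} (hI : Clopen v I)
    {a b c d : Fin n × ℕ} (h : Below v I a b c d) : I c d := by
  obtain ⟨-, hcb, rfl | hdb, hd, hcd, hv⟩ := h
  · exact hcb
  · exact (hI.cotrans c d b hcb hv hcd hdb).resolve_right hd

theorem Clopen.irrefl {I : Fin n × ℕ → Fin n × ℕ → Prop} (hI : Clopen v I) (a : Fin n × ℕ) :
    ¬ I a a := fun h => (hI.sub a a h).1.false

theorem Clopen.below_self {I : Fin n × ℕ → Fin n × ℕ → Prop} (hI : Clopen v I)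
    {a b : Fin n × ℕ} (h : I a b) : Below v I a b a b :=
  ⟨Or.inl rfl, h, Or.inl rfl, hI.irrefl b, hI.lexLt h, (hI.sub a b h).2.2⟩

theorem Clopen.below {I : Fin n × ℕ → Fin n × ℕ → Prop} (hI : Clopen v I) (a b : Fin n × ℕ) :
    Clopen v (Below v I a b) where
  sub c d h := hI.sub c d (hI.below_le h)
  trans c d e h h' := absurd h'.2.1 h.2.2.2.1
  cotrans c d e h hd hcd hde := by
    obtain ⟨hac, hcb, heb, he, -, hv⟩ := h
    by_cases hdb : I d b
    · right
      refine ⟨Or.inr ?_, hdb, heb, he, hde, hv⟩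
      rcases hac with rfl | hac
      · exact hcd
      · exact hac.trans hcd
    · left
      refine ⟨hac, hcb, Or.inr ?_, hdb, hcd, hd⟩
      rcases heb with rfl | heb
      · exact hde
      · exact hde.trans heb

/-! ### Paths in clopen sets -/

/-- A path of a relation `R` between the ends of an element `(a, b)` of a clopen set `I` has a step
`(c, d)` at which it passes from the points `c` with `(a, c) ∈ I` (or `c = a`) to the points `d`
with `(d, b) ∈ I` (or `d = b`). -/
theorem Clopen.exists_crossing_step {I R : Fin n × ℕ → Fin n × ℕ → Prop} (hI : Clopen v I)
    (hR : ∀ a b, R a b → a.1 < b.1 ∧ a.2 < v a.1 ∧ b.2 < v b.1)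
    {a b : Fin n × ℕ} (hab : I a b) (h : Relation.TransGen R a b) :
    ∃ c d, R c d ∧ (a = c ∨ I a c) ∧ (d = b ∨ I d b) := by
  -- The induction is over the final segments of the path that start at a point of the first kind.
  suffices H : ∀ e, Relation.TransGen R e b → (a = e ∨ I a e) →
      ∃ c d, R c d ∧ (a = c ∨ I a c) ∧ (d = b ∨ I d b) from H a h (Or.inl rfl)
  intro e he
  induction he using Relation.TransGen.head_induction_on with
  | single h => exact fun hae => ⟨_, b, h, hae, Or.inl rfl⟩
  | @head e f hef hfb ih =>
    intro hae
    by_cases hf : I f b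
    · exact ⟨e, f, hef, hae, Or.inr hf⟩
    · refine ih (Or.inr ((hI.cotrans a f b hab (hR e f hef).2.2 (Or.inl ?_)
        (Or.inl ?_)).resolve_right hf))
      · rcases hae with rfl | hae
        · exact (hR _ f hef).1
        · exact (hI.sub a e hae).1.trans (hR e f hef).1
      · clear ih hf hef hab h
        induction hfb with
        | single h => exact (hR _ _ h).1
        | tail _ h ih => exact ih.trans (hR _ _ h).1

end MultinomialLattice

/-! ### The sequence `sdSeq` -/

section sdSeq

variable {L : Type*} [Lattice L]

theorem sdSeq_swap (x y z : L) (k : ℕ) : sdSeq x z y k = (sdSeq x y z k).swap := by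
  induction k with
  | zero => rfl
  | succ k ih => simp [sdSeq, ih]

theorem le_sdSeq_fst (x y z : L) (k : ℕ) : y ≤ (sdSeq x y z k).1 := by
  cases k with
  | zero => exact le_rfl
  | succ k => exact le_sup_left

theorem sdSeq_le_succ (x y z : L) (k : ℕ) : sdSeq x y z k ≤ sdSeq x y z (k + 1) := by
  induction k with
  | zero => exact ⟨le_sup_left, le_sup_left⟩
  | succ k ih =>
    exact ⟨sup_le_sup_left (inf_le_inf_left _ ih.2) _, sup_le_sup_left (inf_le_inf_left _ ih.1) _⟩

theorem sdSeq_le_sup (x y z : L) (k : ℕ) :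
    (sdSeq x y z k).1 ≤ y ⊔ z ∧ (sdSeq x y z k).2 ≤ y ⊔ z := by
  induction k with
  | zero => exact ⟨le_sup_left, le_sup_right⟩
  | succ k ih =>
    exact ⟨sup_le le_sup_left (inf_le_right.trans ih.2),
      sup_le le_sup_right (inf_le_right.trans ih.1)⟩

end sdSeq

namespace MultinomialLattice

variable {n : ℕ} {v : Fin n → ℕ}

/-! ### The bound -/

/-- The distance between the letters of an inversion of `x ⊓ (y ⊔ z)` bounds the step of the
iteration at which it appears. -/
theorem inv_sdSeq_of_inv (x : MultinomialLattice v) (k : ℕ) :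
    ∀ (y z : MultinomialLattice v) (a b : Fin n × ℕ), Inv v (x ⊓ (y ⊔ z)).1 a b →
      (b.1 : ℕ) ≤ a.1 + k → Inv v (sdSeq x y z k).1.1 a b := by
  induction k with
  | zero =>
    intro y z a b h hk
    exact absurd h.1 (not_lt.2 hk)
  | succ k ih =>
    intro y z a b h hk
    have hI : Clopen v (Inv v (x ⊓ (y ⊔ z)).1) := clopen_inv _
    have ihy := ih y z
    have ihz : ∀ c d, Inv v (x ⊓ (y ⊔ z)).1 c d → (d.1 : ℕ) ≤ c.1 + k →
        Inv v (sdSeq x y z k).2.1 c d := by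
      have := ih z y
      rwa [sdSeq_swap x y z, sup_comm z y] at this
    obtain ⟨c, d, hcd, hac, hdb⟩ := hI.exists_crossing_step
      (fun a b h => h.elim ((clopen_inv y.1).sub a b) ((clopen_inv z.1).sub a b)) h
      (transGen_of_inv_sup (inv_mono inf_le_right h))
    have hcd' : (c.1 : ℕ) < d.1 := hcd.elim (fun h => h.1) (fun h => h.1)
    have hac' : (a.1 : ℕ) ≤ c.1 := by
      rcases hac with rfl | hac
      · exact le_rfl
      · exact hac.1.le
    have hdb' : (d.1 : ℕ) ≤ b.1 := by
      rcases hdb with rfl | hdb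
      · exact le_rfl
      · exact hdb.1.le
    -- An element with the inversions of distance at most `k` and with `(c, d)` has `(a, b)`.
    have close : ∀ w : MultinomialLattice v,
        (∀ c d, Inv v (x ⊓ (y ⊔ z)).1 c d → (d.1 : ℕ) ≤ c.1 + k → Inv v w.1 c d) →
        Inv v w.1 c d → Inv v w.1 a b := by
      intro w hw hwcd
      have hw' : Clopen v (Inv v w.1) := clopen_inv _
      have had : Inv v w.1 a d := by
        rcases hac with rfl | hac
        · exact hwcd
        · exact hw'.trans _ _ _ (hw a c hac (by omega)) hwcd
      rcases hdb with rfl | hdb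
      · exact had
      · exact hw'.trans _ _ _ had (hw d b hdb (by omega))
    rcases hcd with hcd | hcd
    · exact inv_mono (sdSeq_le_succ x y z k).1
        (close _ ihy (inv_mono (le_sdSeq_fst x y z k) hcd))
    · have hz : z ≤ (sdSeq x y z k).2 := by
        have := le_sdSeq_fst x z y k
        rwa [sdSeq_swap x y z] at this
      have hab : Inv v (sdSeq x y z k).2.1 a b := close _ ihz (inv_mono hz hcd)
      have hJ : ∀ c d, Below v (Inv v (x ⊓ (y ⊔ z)).1) a b c d →
          Inv v (sdSeq x y z k).2.1 c d := by
        intro c d hJ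
        by_cases hdist : (d.1 : ℕ) ≤ c.1 + k
        · exact ihz c d (hI.below_le hJ) hdist
        -- Otherwise `c` and `d` carry the letters of `a` and `b`, and no two occurrences of one
        -- letter are inverted.
        have hZ : Clopen v (Inv v (sdSeq x y z k).2.1) := clopen_inv _
        have hcb : Inv v (sdSeq x y z k).2.1 c b := by
          rcases hJ.1 with rfl | hac
          · exact hab
          · refine (hZ.cotrans a c b hab hJ.2.1.2.1 hac (hI.lexLt hJ.2.1)).resolve_left ?_
            intro hac
            have h1 : (a.1 : ℕ) < c.1 := hac.1
            have h2 : (d.1 : ℕ) ≤ b.1 := by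
              rcases hJ.2.2.1 with rfl | h | h
              exacts [le_rfl, h.le, (congrArg Fin.val h.1).le]
            omega
        rcases hJ.2.2.1 with rfl | hdb
        · exact hcb
        · refine (hZ.cotrans c d b hcb hJ.2.2.2.2.2 hJ.2.2.2.2.1 hdb).resolve_right ?_
          intro hdb
          have h1 : (d.1 : ℕ) < b.1 := hdb.1
          have h2 : (a.1 : ℕ) ≤ c.1 := by
            rcases hJ.1 with rfl | h | h
            exacts [le_rfl, h.le, (congrArg Fin.val h.1).le]
          omega
      exact inv_mono le_sup_right ((hI.below a b).inv_inf
        (fun c d h => inv_mono inf_le_left (hI.below_le h)) hJ (hI.below_self h))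

theorem meetSemidistributiveAt_of_le {k : ℕ} (hk : n - 1 ≤ k) :
    MeetSemidistributiveAt (MultinomialLattice v) k := by
  intro x y z
  refine le_antisymm (inf_le_inf_left _ (sdSeq_le_sup x y z k).1) (le_inf inf_le_left ?_)
  refine (le_iff_inv _ _).2 fun a b h => inv_sdSeq_of_inv x k y z a b h ?_
  have := b.1.isLt
  omega

/-! ### Optimality -/

/-- The pairs of occurrences whose letters are related by `P`. -/
def LetterRel (v : Fin n → ℕ) (P : ℕ → ℕ → Prop) (a b : Fin n × ℕ) : Prop :=
  P a.1 b.1 ∧ a.2 < v a.1 ∧ b.2 < v b.1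

theorem clopen_letterRel {P : ℕ → ℕ → Prop} (hlt : ∀ i j, P i j → i < j)
    (htrans : ∀ i j l, P i j → P j l → P i l)
    (hcotrans : ∀ i j l, P i l → i < j → j < l → P i j ∨ P j l) : Clopen v (LetterRel v P) where
  sub a b h := ⟨hlt _ _ h.1, h.2⟩
  trans a b c h h' := ⟨htrans _ _ _ h.1 h'.1, h.2.1, h'.2.2⟩
  cotrans := by
    rintro ⟨i, p⟩ ⟨j, q⟩ ⟨l, r⟩ ⟨h, hp, hr⟩ hq (hij | ⟨hij, -⟩) hjl
    · rcases hjl with hjl | ⟨hjl, -⟩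
      · exact (hcotrans i j l h hij hjl).imp (fun h => ⟨h, hp, hq⟩) fun h => ⟨h, hq, hr⟩
      · simp only at hjl
        subst hjl
        exact Or.inl ⟨h, hp, hq⟩
    · simp only at hij
      subst hij
      exact Or.inr ⟨h, hq, hr⟩

/-- The pairs `(i, i + 1)` with `i ≡ s` modulo `2`, and the pairs `(0, j)` with `0 < j ≤ m`. -/
def Ladder (s m i j : ℕ) : Prop :=
  (j = i + 1 ∧ (i + s) % 2 = 0) ∨ (i = 0 ∧ 0 < j ∧ j ≤ m)

/-- The parity condition says that `(m, m + 1)` is not in the set. -/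
theorem clopen_ladder {s m : ℕ} (h : (m + s) % 2 = 1) : Clopen v (LetterRel v (Ladder s m)) := by
  apply clopen_letterRel
  · unfold Ladder; omega
  · unfold Ladder; omega
  · unfold Ladder; omega

theorem not_meetSemidistributiveAt (hv : ∀ i, 0 < v i) {k : ℕ} (hk : k + 2 ≤ n) :
    ¬ MeetSemidistributiveAt (MultinomialLattice v) k := by
  intro hSD
  obtain ⟨x, hx⟩ := (clopen_letterRel (v := v) (P := fun i j => i = 0 ∧ 0 < j)
    (by omega) (by omega) (by omega)).exists_inv_iff
  have hL : ∀ s m, ∃ w : MultinomialLattice v, (m + s) % 2 = 1 →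
      ∀ a b, Inv v w.1 a b ↔ LetterRel v (Ladder s m) a b := by
    intro s m
    by_cases h : (m + s) % 2 = 1
    · exact (clopen_ladder h).exists_inv_iff.imp fun w hw _ => hw
    · exact ⟨x, fun h' => absurd h' h⟩
  choose W hW using hL
  have hWx : ∀ s m s' m', (m + s) % 2 = 1 → (m' + s') % 2 = 1 → m ≤ m' →
      x ⊓ W s m ≤ W s' m' := by
    intro s m s' m' h h' hm
    refine (le_iff_inv _ _).2 fun a b hab => (hW s' m' h' a b).2 ?_
    obtain ⟨⟨h0, h1⟩, hv⟩ := (hx a b).1 (inv_mono inf_le_left hab)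
    have h2 := ((hW s m h a b).1 (inv_mono inf_le_right hab)).1
    refine ⟨?_, hv⟩
    unfold Ladder at h2 ⊢
    omega
  have hWW : ∀ s m m', (m + s) % 2 = 1 → (m' + s) % 2 = 1 → m ≤ m' → W s m ≤ W s m' := by
    intro s m m' h h' hm
    refine (le_iff_inv _ _).2 fun a b hab => (hW s m' h' a b).2 ?_
    have h2 := (hW s m h a b).1 hab
    refine ⟨?_, h2.2⟩
    have := h2.1
    unfold Ladder at this ⊢
    omega
  -- For `m ≤ 1` of the right parity the ladder consists of the pairs `(i, i + 1)` with `i ≡ s` only.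
  set y := W (k + 1) (k % 2) with hy
  set z := W k ((k + 1) % 2) with hz
  -- In the ladder that bounds an iterate, `m` is whichever of `l` and `l + 1` has the right parity.
  have key : ∀ l, (sdSeq x y z l).1 ≤ W (k + 1) (l + (l + k) % 2) ∧
      (sdSeq x y z l).2 ≤ W k (l + (l + k + 1) % 2) := by
    intro l
    induction l with
    | zero => simp [sdSeq, hy, hz]
    | succ l ih =>
      constructor
      · exact sup_le (hWW _ _ _ (by omega) (by omega) (by omega))
          ((inf_le_inf_left _ ih.2).trans (hWx _ _ _ _ (by omega) (by omega) (by omega)))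
      · exact sup_le (hWW _ _ _ (by omega) (by omega) (by omega))
          ((inf_le_inf_left _ ih.1).trans (hWx _ _ _ _ (by omega) (by omega) (by omega)))
  have hstep : ∀ j (hj : j + 1 < n) p q, p < v ⟨j, by omega⟩ → q < v ⟨j + 1, hj⟩ →
      Inv v (y ⊔ z).1 (⟨j, by omega⟩, p) (⟨j + 1, hj⟩, q) := by
    intro j hj p q hp hq
    rcases Nat.mod_two_eq_zero_or_one (j + k) with h | h
    · exact inv_mono le_sup_right ((hW _ _ (by omega) _ _).2 ⟨Or.inl ⟨rfl, h⟩, hp, hq⟩)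
    · exact inv_mono le_sup_left
        ((hW _ _ (by omega) _ _).2 ⟨Or.inl ⟨rfl, by simp only; omega⟩, hp, hq⟩)
  have hpath : ∀ j (hj : j + 1 < n) p q, p < v ⟨0, by omega⟩ → q < v ⟨j + 1, hj⟩ →
      Inv v (y ⊔ z).1 (⟨0, by omega⟩, p) (⟨j + 1, hj⟩, q) := by
    intro j
    induction j with
    | zero => exact hstep 0
    | succ j ih =>
      exact fun hj p q hp hq => (clopen_inv _).trans _ _ _ (ih (by omega) p 0 hp (hv _))
        (hstep (j + 1) hj 0 q (hv _) hq)
  have hmem : Inv v (x ⊓ (y ⊔ z)).1 (⟨0, by omega⟩, 0) (⟨k + 1, by omega⟩, 0) := by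
    refine (clopen_letterRel (v := v) (P := fun i j => i = 0 ∧ 0 < j) (by omega)
      (by omega) (by omega)).inv_inf (fun a b => (hx a b).2) ?_ ⟨⟨rfl, by simp⟩, hv _, hv _⟩
    rintro ⟨⟨i, hi⟩, p⟩ ⟨⟨j, hj⟩, q⟩ ⟨⟨h0, h1⟩, hp, hq⟩
    simp only at h0 h1
    subst h0
    obtain ⟨j, rfl⟩ := Nat.exists_eq_add_one.2 h1
    exact hpath j hj p q hp hq
  rw [← hSD x y z] at hmem
  have := ((hW _ _ (by omega) _ _).1 (inv_mono (inf_le_right.trans (key k).1) hmem)).1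
  unfold Ladder at this
  simp only at this
  omega

end MultinomialLattice

theorem mainTheorem3 (n : ℕ) (v : Fin n → ℕ) :
    (∀ k : ℕ, n - 1 ≤ k → MeetSemidistributiveAt (MultinomialLattice v) k) ∧
    ((∀ i, 0 < v i) →
      IsLeast {k : ℕ | MeetSemidistributiveAt (MultinomialLattice v) k} (n - 1)) := by
  refine ⟨fun k hk => MultinomialLattice.meetSemidistributiveAt_of_le hk, fun hv =>
    ⟨MultinomialLattice.meetSemidistributiveAt_of_le le_rfl, fun k hk => ?_⟩⟩
  by_contra hlt
  exact MultinomialLattice.not_meetSemidistributiveAt hv (by omega) hk
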